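/- A (finite) hypergraph $H$ consists of a finite vertex set $V(H)$ and a set $E(H)$ of subsets of $V(H)$, called edges; it is $(d,r)$-regular if every vertex lies in exactly $d$ edges and every edge has exactly $r\ge 2$ vertices, and it is connected if it has a vertex and any two vertices are joined by a walk $v_0e_1v_1\cdots e_lv_l$ with $\{v_{i-1},v_i\}\subseteq e_i\in E(H)$. Its eigenvalues are those of its adjacency matrix $A(H)=(a_{uv})_{u,v\in V(H)}$, where $a_{uv}$ is the number of edges containing both $u$ and $v$ if $u\neq v$, and $a_{uu}=0$. For a connected $(d,r)$-regular hypergraph $H$, the trivial eigenvalue is $d(r-1)$; if $|V(H)|>|E(H)|$ (equivalently $d<r$), then $-d$ is an obvious eigenvalue, with multiplicity $|V(H)|-|E(H)|$, and otherwise there are no obvious eigenvalues. A connected $(d,r)$-regular hypergraph is called Ramanujan if each of its non-trivial, non-obvious eigenvalues $\lambda$ satisfies $$|\lambda-(r-2)|\le 2\sqrt{(d-1)(r-1)}.$$ For every integer $d\ge 3$ there is an infinite family of $(d,d)$-regular Ramanujan hypergraphs, that is, a sequence $H_0,H_1,H_2,\dots$ of connected $(d,d)$-regular Ramanujan hypergraphs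 with $|V(H_0)|<|V(H_1)|<|V(H_2)|<\cdots$ (so that they are pairwise non-isomorphic). -/

import Mathlib

namespace Hypergraph

/-- `H` is `(d, r)`-regular: every vertex lies in exactly `d` edges (`d`-regular), and every edge
has exactly `r` vertices with `r ≥ 2` (`r`-uniform). Cardinalities are taken in `ℕ∞`, so an
infinite set of edges or an infinite edge is never counted as a natural number. -/
def IsBiregular {α : Type*} (H : Hypergraph α) (d r : ℕ) : Prop :=
  (∀ v ∈ H.vertexSet, {e | e ∈ H.edgeSet ∧ v ∈ e}.encard = d) ∧
    2 ≤ r ∧ ∀ e ∈ H.edgeSet, e.encard = r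

/-- `H` is connected: it has a vertex, and any two vertices are joined by a walk, that is, by a
finite sequence of vertices in which consecutive ones lie in a common edge. -/
def IsConnected {α : Type*} (H : Hypergraph α) : Prop :=
  H.vertexSet.Nonempty ∧
    ∀ u ∈ H.vertexSet, ∀ v ∈ H.vertexSet, Relation.ReflTransGen H.Adj u v

open Classical in
/-- The adjacency matrix: for `u ≠ v` the `(u, v)` entry is the number of edges containing both
`u` and `v`; the diagonal is zero. -/
noncomputable def adjacencyMatrix {α : Type*} (H : Hypergraph α) :
    Matrix H.vertexSet H.vertexSet ℝ :=
  Matrix.of fun u v =>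
    if u = v then 0 else ({e | e ∈ H.edgeSet ∧ u.1 ∈ e ∧ v.1 ∈ e}.ncard : ℝ)

open Classical in
/-- The spectrum of a finite hypergraph: the multiset of the eigenvalues of its adjacency matrix.
That matrix is real symmetric, so all its eigenvalues are real. -/
noncomputable def eigenvalues {α : Type*} (H : Hypergraph α) [Fintype H.vertexSet] :
    Multiset ℝ :=
  H.adjacencyMatrix.charpoly.roots

/-- The non-obvious eigenvalues of a `d`-regular finite hypergraph. If there are more vertices
than edges, then `-d` is an obvious eigenvalue, with multiplicity the number of vertices minus
the number of edges, and these copies of `-d` are removed from the spectrum; otherwise there are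
no obvious eigenvalues (the subtraction of natural numbers is then zero). -/
noncomputable def nonObviousEigenvalues {α : Type*} (H : Hypergraph α) [Fintype H.vertexSet]
    (d : ℕ) : Multiset ℝ :=
  H.eigenvalues - Multiset.replicate (H.vertexSet.ncard - H.edgeSet.ncard) (-(d : ℝ))

/-- `H` is a `(d, r)`-regular Ramanujan hypergraph: it is connected and `(d, r)`-regular, and each
non-obvious eigenvalue other than the trivial one, `d (r - 1)`, is at distance at most
`2 √((d - 1) (r - 1))` from `r - 2`. -/
def IsRamanujan {α : Type*} (H : Hypergraph α) [Fintype H.vertexSet] (d r : ℕ) : Prop :=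
  H.IsConnected ∧ H.IsBiregular d r ∧
    ∀ μ ∈ H.nonObviousEigenvalues d, μ ≠ (d : ℝ) * ((r : ℝ) - 1) →
      |μ - ((r : ℝ) - 2)| ≤ 2 * √(((d : ℝ) - 1) * ((r : ℝ) - 1))

end Hypergraph

/-! If `B` is the vertex-edge incidence matrix, the adjacency matrix is `B * Bᵀ - d`. For `r = d`
the Ramanujan condition reads `0 ≤ μ + d ≤ 4 (d - 1)`, and the lower bound is automatic. So it
suffices to find d-regular bipartite graphs with singular values at most `2 √(d - 1)` on zero-sum
vectors, and with distinct columns so that no two edges coincide as sets.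

These come from the Marcus–Spielman–Srivastava method: start from a complete bipartite graph minus a
perfect matching and take 2-lifts repeatedly. The new singular values of a lift are those of a
signing of `B`, so each stage needs a good signing (`exists_signed_le`).

Two facts give one. The characteristic polynomials of all signings sum to a multiple of the matching
polynomial, which is positive beyond `2 √(d - 1)` by the Heilmann–Lieb recursion (`sum_det_pos`).
And a signed adjacency matrix plus `d` is a sum of independently chosen rank one matrices, so a
bound on the largest root of the sum passes to some choice (`exists_choice_charpoly_pos`); the
interlacing behind this is the nonvanishing of the summed determinants on matrices with positive
definite imaginary part (`ImPosDef.choiceDet_ne_zero`). -/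

open Matrix Polynomial Filter

/-! ### Interlacing for sums of rank one choices. -/

namespace Matrix

section Interlacing

variable {V : Type*} [Fintype V] [DecidableEq V]

/-- The imaginary part `(Z - Zᴴ) / 2i` of `Z` is positive definite. -/
def ImPosDef (Z : Matrix V V ℂ) : Prop :=
  ∀ x : V → ℂ, x ≠ 0 → 0 < (star x ⬝ᵥ Z *ᵥ x).im

/-- The rank one matrix `v vᵀ`, for a real vector `v`, with complex entries. -/
noncomputable def rankOne (v : V → ℝ) : Matrix V V ℂ :=
  (vecMulVec v v).map Complex.ofReal

omit [DecidableEq V] in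
lemma star_dotProduct_rankOne (v : V → ℝ) (x : V → ℂ) :
    star x ⬝ᵥ rankOne v *ᵥ x = (Complex.normSq ((fun i => (v i : ℂ)) ⬝ᵥ x) : ℂ) := by
  have h : rankOne v = vecMulVec (fun i => (v i : ℂ)) (fun i => (v i : ℂ)) := by
    ext i j; simp [rankOne, vecMulVec_apply]
  rw [h, vecMulVec_mulVec, ← Complex.mul_conj]
  have h2 : (starRingEnd ℂ) ((fun i => (v i : ℂ)) ⬝ᵥ x) = star x ⬝ᵥ (fun i => (v i : ℂ)) := by
    simp [dotProduct, mul_comm]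
  rw [h2, dotProduct_smul]
  simp [mul_comm]

omit [DecidableEq V] in
lemma ImPosDef.sub_smul_rankOne {Z : Matrix V V ℂ} (hZ : ImPosDef Z) (v : V → ℝ) {t : ℂ}
    (ht : t.im ≤ 0) : ImPosDef (Z - t • rankOne v) := by
  intro x hx
  have h := hZ x hx
  rw [sub_mulVec, dotProduct_sub, smul_mulVec, dotProduct_smul, star_dotProduct_rankOne]
  simp only [smul_eq_mul, Complex.sub_im, Complex.mul_im, Complex.ofReal_im, Complex.ofReal_re]
  nlinarith [Complex.normSq_nonneg ((fun i => (v i : ℂ)) ⬝ᵥ x)]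

lemma ImPosDef.det_ne_zero {Z : Matrix V V ℂ} (hZ : ImPosDef Z) : Z.det ≠ 0 := by
  intro h
  obtain ⟨x, hx, h0⟩ := exists_mulVec_eq_zero_iff.mpr h
  have := hZ x hx
  simp [h0] at this

omit [DecidableEq V] in
lemma ImPosDef.sub_sum_rankOne {Z : Matrix V V ℂ} (hZ : ImPosDef Z) {ι : Type*} (s : Finset ι)
    (r : ι → V → ℝ) : ImPosDef (Z - ∑ i ∈ s, rankOne (r i)) := by
  classical
  induction s using Finset.induction_on with
  | empty => simpa using hZ
  | insert a s ha ih =>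
    have := ih.sub_smul_rankOne (r a) (t := 1) (by simp)
    rw [Finset.sum_insert ha, add_comm, ← sub_sub]
    simpa using this

/-- By the matrix determinant lemma a rank one perturbation changes the determinant affinely. -/
lemma ImPosDef.exists_det_sub_smul_rankOne {Z : Matrix V V ℂ} (hZ : ImPosDef Z) (v : V → ℝ) :
    ∃ G : ℂ, ∀ t : ℂ, (Z - t • rankOne v).det = Z.det - t * G := by
  have hu : IsUnit Z.det := hZ.det_ne_zero.isUnit
  set w : V → ℂ := fun i => (v i : ℂ)
  refine ⟨Z.det * (w ⬝ᵥ Z⁻¹ *ᵥ w), fun t => ?_⟩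
  have h : Z - t • rankOne v = Z + replicateCol Unit (-t • w) * replicateRow Unit w := by
    ext i j
    simp [rankOne, vecMulVec_apply, w, Matrix.mul_apply]
    ring
  rw [h, det_add_replicateCol_mul_replicateRow hu, det_unique (n := Unit)]
  have h2 : (replicateRow Unit w * Z⁻¹ * replicateCol Unit (-t • w)) () ()
      = -t * (w ⬝ᵥ Z⁻¹ *ᵥ w) := by
    rw [Matrix.mul_assoc, ← replicateCol_mulVec]
    rw [mulVec_smul]
    simp [Matrix.mul_apply, dotProduct, Finset.mul_sum, mul_left_comm]
  simp only [PUnit.default_eq_unit, add_apply, one_apply_eq, h2]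
  ring

/-- The sum, over all choices `s`, of the determinants of `Z - ∑ᵢ r_{i,s(i)} r_{i,s(i)}ᵀ`. -/
noncomputable def choiceDet {m : ℕ} (r : Fin m → Bool → V → ℝ) (Z : Matrix V V ℂ) : ℂ :=
  ∑ s : Fin m → Bool, (Z - ∑ i, rankOne (r i (s i))).det

lemma exists_choiceDet_sub_smul_rankOne {m : ℕ} (r : Fin m → Bool → V → ℝ)
    {Z : Matrix V V ℂ} (hZ : ImPosDef Z) (v : V → ℝ) :
    ∃ G : ℂ, ∀ t : ℂ, choiceDet r (Z - t • rankOne v) = choiceDet r Z - t * G := by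
  have := fun s : Fin m → Bool =>
    (hZ.sub_sum_rankOne Finset.univ fun i => r i (s i)).exists_det_sub_smul_rankOne v
  choose G hG using this
  refine ⟨∑ s, G s, fun t => ?_⟩
  simp only [choiceDet, Finset.mul_sum, ← Finset.sum_sub_distrib]
  refine Finset.sum_congr rfl fun s _ => ?_
  rw [← hG s t, sub_right_comm]

/-- If `G ≠ 0`, then `F / G` is a zero of `F - t * G`, so it lies in the open upper half plane and
its inverse in the lower one. -/
lemma div_im_neg_of_forall_ne_zero {F G : ℂ} (h : ∀ t : ℂ, t.im ≤ 0 → F - t * G ≠ 0) :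
    (G / F).im < 0 ∨ G = 0 := by
  by_contra! hc
  obtain ⟨h1, h2⟩ := hc
  refine h (F / G) ?_ (by field_simp; simp)
  rw [← inv_div, Complex.inv_im]
  exact div_nonpos_of_nonpos_of_nonneg (by linarith) (Complex.normSq_nonneg _)

lemma sum_choice_succ {m : ℕ} {M : Type*} [AddCommMonoid M] (f : (Fin (m + 1) → Bool) → M) :
    ∑ s, f s = ∑ s : Fin m → Bool, f (Fin.cons true s) +
      ∑ s : Fin m → Bool, f (Fin.cons false s) := by
  rw [← (Fin.consEquiv fun _ => Bool).sum_comp, Fintype.sum_prod_type, Fintype.sum_bool]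
  rfl

lemma choiceDet_succ {m : ℕ} (r : Fin (m + 1) → Bool → V → ℝ) (Z : Matrix V V ℂ) :
    choiceDet r Z = choiceDet (fun i => r i.succ) (Z - rankOne (r 0 true)) +
      choiceDet (fun i => r i.succ) (Z - rankOne (r 0 false)) := by
  simp [choiceDet, sum_choice_succ, Fin.sum_univ_succ, sub_sub]

/-- Nonvanishing is assumed only for this `r`, so that the induction proving it in general can use
the result for its shorter families. -/
theorem ImPosDef.div_im_of_choiceDet {m : ℕ} {r : Fin m → Bool → V → ℝ}
    (hr : ∀ Z : Matrix V V ℂ, ImPosDef Z → choiceDet r Z ≠ 0)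
    {Z : Matrix V V ℂ} (hZ : ImPosDef Z) (v : V → ℝ) :
    ((choiceDet r Z - choiceDet r (Z - rankOne v)) / choiceDet r Z).im < 0 ∨
      choiceDet r Z - choiceDet r (Z - rankOne v) = 0 := by
  obtain ⟨G, hG⟩ := exists_choiceDet_sub_smul_rankOne r hZ v
  have h1 : choiceDet r Z - choiceDet r (Z - rankOne v) = G := by
    have := hG 1
    rw [one_smul, one_mul] at this
    rw [this]; ring
  rw [h1]
  refine div_im_neg_of_forall_ne_zero fun t ht => ?_
  rw [← hG t]
  exact hr _ (hZ.sub_smul_rankOne v ht)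

theorem ImPosDef.choiceDet_ne_zero {m : ℕ} (r : Fin m → Bool → V → ℝ)
    {Z : Matrix V V ℂ} (hZ : ImPosDef Z) : choiceDet r Z ≠ 0 := by
  induction m generalizing Z with
  | zero => simpa [choiceDet] using hZ.det_ne_zero
  | succ m ih =>
    rw [choiceDet_succ]
    set F := choiceDet (fun i => r i.succ) Z with hF
    have hF0 : F ≠ 0 := ih _ hZ
    have ha := hZ.div_im_of_choiceDet (fun _ h => ih (fun i => r i.succ) h) (r 0 true)
    have hb := hZ.div_im_of_choiceDet (fun _ h => ih (fun i => r i.succ) h) (r 0 false)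
    rw [← hF] at ha hb
    set a := choiceDet (fun i => r i.succ) (Z - rankOne (r 0 true))
    set b := choiceDet (fun i => r i.succ) (Z - rankOne (r 0 false))
    intro h
    -- If `a + b = 0`, these two quotients add up to 2; but each is zero or has negative imaginary
    -- part.
    have h2 : (F - a) / F + (F - b) / F = 2 := by
      field_simp
      linear_combination -h
    have h3 := congrArg Complex.im h2
    rw [Complex.add_im] at h3
    rcases ha with ha | ha <;> rcases hb with hb | hb
    · norm_num at h3; linarith
    · rw [hb] at h3; norm_num at h3; linarith
    · rw [ha] at h3; norm_num at h3; linarith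
    · rw [ha, hb] at h2; norm_num at h2

/-- The sum, over all choices `s`, of the characteristic polynomials of
`A + ∑ᵢ r_{i,s(i)} r_{i,s(i)}ᵀ`. -/
noncomputable def choicePoly {m : ℕ} (r : Fin m → Bool → V → ℝ) (A : Matrix V V ℝ) : ℝ[X] :=
  ∑ s : Fin m → Bool, (A + ∑ i, vecMulVec (r i (s i)) (r i (s i))).charpoly

lemma choicePoly_succ {m : ℕ} (r : Fin (m + 1) → Bool → V → ℝ) (A : Matrix V V ℝ) :
    choicePoly r A =
      choicePoly (fun i => r i.succ) (A + vecMulVec (r 0 true) (r 0 true)) +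
      choicePoly (fun i => r i.succ) (A + vecMulVec (r 0 false) (r 0 false)) := by
  simp [choicePoly, sum_choice_succ, Fin.sum_univ_succ, add_assoc]

lemma aeval_choicePoly {m : ℕ} (r : Fin m → Bool → V → ℝ) (A : Matrix V V ℝ) (z : ℂ) :
    aeval z (choicePoly r A) =
      choiceDet r (Matrix.scalar V z - A.map Complex.ofReal) := by
  simp only [choicePoly, choiceDet, map_sum]
  refine Finset.sum_congr rfl fun s _ => ?_
  rw [aeval_def, ← eval_map, ← charpoly_map, eval_charpoly]
  congr 1
  ext i j
  simp [rankOne, Matrix.sum_apply, sub_sub]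

lemma degree_choicePoly_sub_lt {m : ℕ} (r : Fin m → Bool → V → ℝ) (A A' : Matrix V V ℝ) :
    (choicePoly r A - choicePoly r A').degree < (Fintype.card V : WithBot ℕ) := by
  rw [choicePoly, choicePoly, ← Finset.sum_sub_distrib]
  refine (degree_sum_le _ _).trans_lt
    ((Finset.sup_lt_iff (WithBot.bot_lt_coe _)).mpr fun s _ => ?_)
  rw [← charpoly_degree_eq_dim (A + ∑ i, vecMulVec (r i (s i)) (r i (s i)))]
  refine degree_sub_lt_left (by simp [charpoly_degree_eq_dim]) (charpoly_monic _).ne_zero ?_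
  rw [(charpoly_monic _).leadingCoeff, (charpoly_monic _).leadingCoeff]

lemma coeff_choicePoly {m : ℕ} (r : Fin m → Bool → V → ℝ) (A : Matrix V V ℝ) :
    (choicePoly r A).coeff (Fintype.card V) = 2 ^ m := by
  have h : ∀ s : Fin m → Bool, (A + ∑ i, vecMulVec (r i (s i)) (r i (s i))).charpoly.coeff
      (Fintype.card V) = 1 := fun s => by
    rw [← charpoly_natDegree_eq_dim (A + ∑ i, vecMulVec (r i (s i)) (r i (s i)))]
    exact charpoly_monic _
  simp [choicePoly, finsetSum_coeff, h]

lemma degree_choicePoly {m : ℕ} (r : Fin m → Bool → V → ℝ) (A : Matrix V V ℝ) :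
    (choicePoly r A).degree = (Fintype.card V : WithBot ℕ) := by
  refine le_antisymm ?_ (le_degree_of_ne_zero (by simp [coeff_choicePoly]))
  refine (degree_sum_le _ _).trans (Finset.sup_le fun s _ => ?_)
  rw [charpoly_degree_eq_dim]

lemma leadingCoeff_choicePoly {m : ℕ} (r : Fin m → Bool → V → ℝ) (A : Matrix V V ℝ) :
    (choicePoly r A).leadingCoeff = 2 ^ m := by
  rw [leadingCoeff, natDegree_eq_of_degree_eq_some (degree_choicePoly r A), coeff_choicePoly]

lemma imPosDef_scalar_sub {A : Matrix V V ℝ} (hA : A.IsSymm) {z : ℂ} (hz : 0 < z.im) :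
    ImPosDef (Matrix.scalar V z - A.map Complex.ofReal) := by
  intro x hx
  have hH : (A.map Complex.ofReal).IsHermitian := by
    ext i j
    simp [hA.apply i j]
  have h1 : (star x ⬝ᵥ A.map Complex.ofReal *ᵥ x).im = 0 :=
    hH.im_star_dotProduct_mulVec_self x
  have h2 : star x ⬝ᵥ Matrix.scalar V z *ᵥ x = z * ((∑ i, Complex.normSq (x i) : ℝ) : ℂ) := by
    rw [Complex.ofReal_sum, Finset.mul_sum]
    refine Finset.sum_congr rfl fun i _ => ?_
    rw [← Complex.mul_conj]
    simp [mulVec_diagonal]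
    ring
  rw [sub_mulVec, dotProduct_sub, Complex.sub_im, h1, h2, sub_zero]
  obtain ⟨i, hi⟩ := Function.ne_iff.mp hx
  simp only [Complex.mul_im, Complex.ofReal_im, Complex.ofReal_re, mul_zero, zero_add]
  exact mul_pos hz (Finset.sum_pos' (fun i _ => Complex.normSq_nonneg _)
    ⟨i, Finset.mem_univ _, Complex.normSq_pos.mpr hi⟩)

/-- On the real axis the quotient is real, and its real derivative is the derivative of its
imaginary part in the direction `I`, along which that part goes from zero to nonpositive values. -/
lemma deriv_div_nonpos_of_im_nonpos {g u : ℝ[X]}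
    (h : ∀ z : ℂ, 0 < z.im → (aeval z g / aeval z u).im ≤ 0) {x : ℝ} (hx : u.eval x ≠ 0) :
    deriv (fun x => g.eval x / u.eval x) x ≤ 0 := by
  have e : ∀ (p : ℝ[X]) (y : ℝ), aeval (y : ℂ) p = ((p.eval y : ℝ) : ℂ) := fun p y => by
    rw [aeval_def, ← Complex.coe_algebraMap, eval₂_at_apply]
  set D := (g.derivative.eval x * u.eval x - g.eval x * u.derivative.eval x) / u.eval x ^ 2
  have hD : HasDerivAt (fun x => g.eval x / u.eval x) D x :=
    (g.hasDerivAt x).div (u.hasDerivAt x) hx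
  have hC : HasDerivAt (fun z : ℂ => aeval z g / aeval z u) (D : ℂ) (x : ℂ) := by
    have hval : (D : ℂ) = (aeval (x : ℂ) (derivative g) * aeval (x : ℂ) u -
        aeval (x : ℂ) g * aeval (x : ℂ) (derivative u)) / aeval (x : ℂ) u ^ 2 := by
      simp [D, e]
    rw [hval]
    exact (g.hasDerivAt_aeval (x : ℂ)).div (u.hasDerivAt_aeval (x : ℂ))
      (by rw [e]; exact_mod_cast hx)
  have hline : HasDerivAt (fun t : ℝ => (x : ℂ) + t * Complex.I) Complex.I 0 := by
    simpa using ((Complex.ofRealCLM.hasDerivAt (x := (0 : ℝ))).mul_const Complex.I).const_add (x : ℂ)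
  have hC' : HasDerivAt (fun z : ℂ => aeval z g / aeval z u) (D : ℂ)
      ((x : ℂ) + ((0 : ℝ) : ℂ) * Complex.I) := by simpa using hC
  have hcomp := (hC'.comp (0 : ℝ) hline)
  have him : HasDerivAt (fun t : ℝ => (aeval ((x : ℂ) + t * Complex.I) g /
      aeval ((x : ℂ) + t * Complex.I) u).im) D 0 := by
    have := Complex.imCLM.hasFDerivAt.comp_hasDerivAt (0 : ℝ) hcomp
    rw [Complex.imCLM_apply, mul_comm, Complex.I_mul_im, Complex.ofReal_re] at this
    exact this
  rw [hD.deriv]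
  have hlim := him.tendsto_slope_zero_right
  refine le_of_tendsto hlim ?_
  filter_upwards [self_mem_nhdsWithin] with t ht
  have h0 : (aeval ((x : ℂ) + ((0 : ℝ) : ℂ) * Complex.I) g /
      aeval ((x : ℂ) + ((0 : ℝ) : ℂ) * Complex.I) u).im = 0 := by
    simp only [Complex.ofReal_zero, zero_mul, add_zero, e, ← Complex.ofReal_div,
      Complex.ofReal_im]
  rw [h0, zero_add, sub_zero, smul_eq_mul]
  have ht' : 0 < t := ht
  exact mul_nonpos_of_nonneg_of_nonpos (by positivity) (h _ (by simpa using ht'))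

lemma antitoneOn_div_of_im_nonpos {g u : ℝ[X]}
    (h : ∀ z : ℂ, 0 < z.im → (aeval z g / aeval z u).im ≤ 0) {c : ℝ}
    (hc : ∀ x, c < x → u.eval x ≠ 0) :
    AntitoneOn (fun x => g.eval x / u.eval x) (Set.Ioi c) := by
  have hd : ∀ x ∈ Set.Ioi c, DifferentiableAt ℝ (fun x => g.eval x / u.eval x) x := fun x hx =>
    (g.differentiable x).fun_div (u.differentiable x) (hc x hx)
  refine antitoneOn_of_deriv_nonpos (convex_Ioi c)
    (fun x hx => (hd x hx).continuousAt.continuousWithinAt) ?_ ?_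
  · rw [interior_Ioi]
    exact fun x hx => (hd x hx).differentiableWithinAt
  · rw [interior_Ioi]
    exact fun x hx => deriv_div_nonpos_of_im_nonpos h (hc x hx)

/-- If `g / u` maps the upper half plane to the closed lower half plane and vanishes at infinity,
then `g` is nonnegative to the right of the zeros of `u`. -/
lemma eval_nonneg_of_im_nonpos {g u : ℝ[X]}
    (h : ∀ z : ℂ, 0 < z.im → (aeval z g / aeval z u).im ≤ 0) (hdeg : g.degree < u.degree) {c : ℝ}
    (hc : ∀ x, c < x → 0 < u.eval x) {x : ℝ} (hx : c ≤ x) : 0 ≤ g.eval x := by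
  have key : ∀ y ∈ Set.Ioi c, 0 ≤ g.eval y := by
    intro y hy
    have hanti := antitoneOn_div_of_im_nonpos h (fun x hx => (hc x hx).ne')
    have hlim := div_tendsto_atTop_zero_of_degree_lt g u hdeg
    have : 0 ≤ g.eval y / u.eval y := by
      refine le_of_tendsto hlim ?_
      filter_upwards [eventually_ge_atTop y] with t ht
      exact hanti hy (lt_of_lt_of_le hy ht) ht
    have h2 := mul_nonneg this (hc y hy).le
    rwa [div_mul_cancel₀ _ (hc y hy).ne'] at h2
  have hcl : x ∈ closure (Set.Ioi c) := by rw [closure_Ioi]; exact hx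
  exact closure_minimal (t := {y | 0 ≤ g.eval y}) key
    (isClosed_le continuous_const g.continuous) hcl

lemma eval_pos_of_no_root {u : ℝ[X]} (hu : 0 < u.degree) (hl : 0 < u.leadingCoeff) {c : ℝ}
    (hc : ∀ x, c < x → u.eval x ≠ 0) {x : ℝ} (hx : c < x) : 0 < u.eval x := by
  by_contra! hneg
  obtain ⟨y, hy1, hy2⟩ := ((u.tendsto_atTop_of_leadingCoeff_nonneg hu hl.le).eventually_ge_atTop 0
    |>.and (eventually_ge_atTop x)).exists
  obtain ⟨z, hz, hz0⟩ := intermediate_value_Icc hy2 u.continuous.continuousOn ⟨hneg, hy1⟩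
  exact hc z (hx.trans_le hz.1) hz0

/-- Selecting one of two summands which have a common interlacing with `u`. -/
lemma eval_pos_or_eval_pos {u a b : ℝ[X]} (hu : 0 < u.degree) (hl : 0 < u.leadingCoeff)
    (ha : ∀ z : ℂ, 0 < z.im → (aeval z (u - a) / aeval z u).im ≤ 0)
    (hb : ∀ z : ℂ, 0 < z.im → (aeval z (u - b) / aeval z u).im ≤ 0)
    (hda : (u - a).degree < u.degree) (hdb : (u - b).degree < u.degree) {R : ℝ}
    (hab : ∀ x, R < x → 0 < (a + b).eval x) :
    (∀ x, R < x → 0 < a.eval x) ∨ (∀ x, R < x → 0 < b.eval x) := by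
  have hu0 : u ≠ 0 := by rintro rfl; simp at hu
  -- At the largest root of `u`, both `u - a` and `u - b` are nonnegative, so `a + b ≤ 0` there;
  -- hence this root cannot exceed `R`.
  have hroot : ∀ x, R < x → u.eval x ≠ 0 := by
    intro x hx hx0
    have hne : u.roots.toFinset.Nonempty := ⟨x, by simp [hu0, hx0]⟩
    obtain ⟨c, hcm, hcmax⟩ := u.roots.toFinset.exists_max_image id hne
    have hcroot : u.eval c = 0 := by simpa [hu0] using hcm
    have hxc : x ≤ c := hcmax x (by simp [hu0, hx0])
    have hpos : ∀ y, c < y → 0 < u.eval y := fun y hy =>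
      eval_pos_of_no_root hu hl (c := c) (fun z hz hz0 =>
        absurd (hcmax z (by simp [hu0, hz0])) (not_le.mpr hz)) hy
    have h1 := eval_nonneg_of_im_nonpos ha hda hpos le_rfl
    have h2 := eval_nonneg_of_im_nonpos hb hdb hpos le_rfl
    have h3 := hab c (hx.trans_le hxc)
    simp only [eval_sub, eval_add, hcroot] at h1 h2 h3
    linarith
  have hpos : ∀ x, R < x → 0 < u.eval x := fun x hx => eval_pos_of_no_root hu hl hroot hx
  by_contra! hc
  obtain ⟨⟨x, hx, hxa⟩, ⟨y, hy, hyb⟩⟩ := hc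
  have hA := antitoneOn_div_of_im_nonpos ha hroot
  have hB := antitoneOn_div_of_im_nonpos hb hroot
  have hm : R < min x y := lt_min hx hy
  -- Where `a ≤ 0` the quotient `(u - a) / u` is at least 1, and monotonicity carries this left to
  -- `min x y`; the same for `b` makes `a + b ≤ 0` at that common point.
  have h1 : 1 ≤ (u - a).eval (min x y) / u.eval (min x y) := by
    refine le_trans ?_ (hA hm hx (min_le_left _ _))
    rw [le_div_iff₀ (hpos x hx), eval_sub]; linarith
  have h2 : 1 ≤ (u - b).eval (min x y) / u.eval (min x y) := by
    refine le_trans ?_ (hB hm hy (min_le_right _ _))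
    rw [le_div_iff₀ (hpos y hy), eval_sub]; linarith
  rw [le_div_iff₀ (hpos _ hm), eval_sub] at h1 h2
  have h3 := hab _ hm
  rw [eval_add] at h3
  linarith

lemma im_aeval_choicePoly_div_nonpos {m : ℕ} (r : Fin m → Bool → V → ℝ) {A : Matrix V V ℝ}
    (hA : A.IsSymm) (v : V → ℝ) {z : ℂ} (hz : 0 < z.im) :
    (aeval z (choicePoly r A - choicePoly r (A + vecMulVec v v)) /
      aeval z (choicePoly r A)).im ≤ 0 := by
  have hZ := imPosDef_scalar_sub hA hz
  have h : Matrix.scalar V z - (A + vecMulVec v v).map Complex.ofReal =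
      Matrix.scalar V z - A.map Complex.ofReal - rankOne v := by
    ext i j
    simp [rankOne, sub_sub]
  rw [map_sub, aeval_choicePoly, aeval_choicePoly, h]
  rcases hZ.div_im_of_choiceDet (fun _ h => h.choiceDet_ne_zero r) v with h1 | h1
  · exact h1.le
  · rw [h1]; simp

/-- If the sum of the characteristic polynomials of `A + ∑ᵢ r_{i,s(i)} r_{i,s(i)}ᵀ` over all
choices `s` is positive to the right of `R`, then so is the one for some choice. -/
theorem exists_choice_charpoly_pos [Nonempty V] {m : ℕ} (r : Fin m → Bool → V → ℝ)
    {A : Matrix V V ℝ} (hA : A.IsSymm) {R : ℝ}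
    (hR : ∀ x, R < x → 0 < (choicePoly r A).eval x) :
    ∃ s : Fin m → Bool, ∀ x, R < x →
      0 < (A + ∑ i, vecMulVec (r i (s i)) (r i (s i))).charpoly.eval x := by
  induction m generalizing A with
  | zero => exact ⟨fun _ => true, by simpa [choicePoly] using hR⟩
  | succ m ih =>
    rw [choicePoly_succ] at hR
    set r' : Fin m → Bool → V → ℝ := fun i => r i.succ
    have hsymm : ∀ v : V → ℝ, (A + vecMulVec v v).IsSymm := fun v =>
      hA.add (by ext i j; simp [vecMulVec_apply, mul_comm])
    have step : ∀ b, (∀ x, R < x →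
        0 < (choicePoly r' (A + vecMulVec (r 0 b) (r 0 b))).eval x) →
        ∃ s : Fin (m + 1) → Bool, ∀ x, R < x →
          0 < (A + ∑ i, vecMulVec (r i (s i)) (r i (s i))).charpoly.eval x := by
      intro b hb
      obtain ⟨s, hs⟩ := ih r' (hsymm _) hb
      refine ⟨Fin.cons b s, fun x hx => ?_⟩
      simpa [Fin.sum_univ_succ, ← add_assoc] using hs x hx
    -- Leaving out the first rank one term gives the polynomial that interlaces both alternatives.
    rcases eval_pos_or_eval_pos (u := choicePoly r' A)
      (by rw [degree_choicePoly]; exact_mod_cast Fintype.card_pos)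
      (by rw [leadingCoeff_choicePoly]; positivity)
      (fun z hz => im_aeval_choicePoly_div_nonpos r' hA (r 0 true) hz)
      (fun z hz => im_aeval_choicePoly_div_nonpos r' hA (r 0 false) hz)
      (by rw [degree_choicePoly r' A]; exact degree_choicePoly_sub_lt _ _ _)
      (by rw [degree_choicePoly r' A]; exact degree_choicePoly_sub_lt _ _ _) hR with h | h
    · exact step true h
    · exact step false h

end Interlacing
end Matrix

/-! ### The matching polynomial as an average over signs. -/

namespace Matrix

section MatchingPolynomial

variable {W : Type*} [Fintype W] [DecidableEq W]

/-- Only permutations with `σ v = w` contribute, and they meet row `w` and column `v` nowhere else.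
-/
lemma det_eq_of_row_eq_single {N N' : Matrix W W ℝ} {w v : W} (h : N w = Pi.single v 1)
    (h' : N' w = Pi.single v 1) (hN : ∀ i j, i ≠ w → j ≠ v → N i j = N' i j) :
    N.det = N'.det := by
  rw [det_apply', det_apply']
  refine Finset.sum_congr rfl fun σ _ => ?_
  congr 1
  by_cases hσ : σ v = w
  · refine Finset.prod_congr rfl fun i _ => ?_
    by_cases hi : i = v
    · rw [hi, hσ, h, h']
    · exact hN _ _ (fun hw => hi (σ.injective (hw.trans hσ.symm))) hi
  · have hi : σ.symm w ≠ v := fun hi => hσ (by rw [← hi, Equiv.apply_symm_apply])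
    rw [Finset.prod_eq_zero (Finset.mem_univ (σ.symm w)) (by simp [h, hi]),
      Finset.prod_eq_zero (Finset.mem_univ (σ.symm w)) (by simp [h', hi])]

/-- The matrix `M` restricted to the rows and columns in `S`, and extended by the identity. -/
def restrictOne (S : Finset W) (M : Matrix W W ℝ) : Matrix W W ℝ :=
  of fun i j => if i ∈ S ∧ j ∈ S then M i j else if i = j then 1 else 0

lemma det_restrictOne_updateRow_self {S : Finset W} (M : Matrix W W ℝ) {v : W} :
    ((restrictOne S M).updateRow v (Pi.single v 1)).det = (restrictOne (S.erase v) M).det := by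
  refine det_eq_of_row_eq_single (w := v) (v := v) (by simp) ?_ fun i j hi hj => ?_
  · ext j
    rcases eq_or_ne j v with rfl | hj
    · simp [restrictOne]
    · simp [restrictOne, hj, hj.symm]
  · simp [hi, hj, restrictOne]

lemma det_restrictOne_updateRow_swap {S : Finset W} (M : Matrix W W ℝ) {u v : W} (huv : u ≠ v) :
    (((restrictOne S M).updateRow v (Pi.single u 1)).updateRow u (Pi.single v 1)).det =
      -(restrictOne ((S.erase v).erase u) M).det := by
  have h1 : (((restrictOne S M).updateRow v (Pi.single u 1)).updateRow u (Pi.single v 1)) =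
      (((restrictOne S M).updateRow v (Pi.single v 1)).updateRow u (Pi.single u 1)).submatrix
        (Equiv.swap u v) id := by
    ext i j
    rcases eq_or_ne i u with rfl | hi
    · simp [updateRow_apply, huv.symm]
    · rcases eq_or_ne i v with rfl | hi'
      · simp [updateRow_apply, hi]
      · simp [updateRow_apply, hi, hi', Equiv.swap_apply_of_ne_of_ne]
  rw [h1, det_permute, Equiv.Perm.sign_swap huv, ← det_restrictOne_updateRow_self]
  have h2 : (((restrictOne S M).updateRow v (Pi.single v 1)).updateRow u (Pi.single u 1)).det =
      ((restrictOne (S.erase v) M).updateRow u (Pi.single u 1)).det := by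
    refine det_eq_of_row_eq_single (w := v) (v := v) ?_ ?_ fun i j hi hj => ?_
    · ext j; simp [updateRow_apply, huv.symm]
    · ext j
      rcases eq_or_ne j v with rfl | hj
      · simp [updateRow_apply, huv.symm, restrictOne]
      · simp [updateRow_apply, huv.symm, restrictOne, hj, hj.symm]
    · simp [updateRow_apply, hi, hj, restrictOne]
  rw [h2]
  simp

/-- The expansion of a principal minor along a row and a column. -/
lemma det_restrictOne_expand {S : Finset W} (M : Matrix W W ℝ) {v : W} (hv : v ∈ S) :
    (restrictOne S M).det = M v v * (restrictOne (S.erase v) M).det +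
      ∑ u ∈ S.erase v, ∑ w ∈ S.erase v, M v u * M w v *
        (((restrictOne S M).updateRow v (Pi.single u 1)).updateRow w (Pi.single v 1)).det := by
  rw [det_eq_sum_mul_adjugate_row _ v]
  have h1 : ∑ j, restrictOne S M v j * adjugate (restrictOne S M) j v =
      ∑ j ∈ S, M v j * adjugate (restrictOne S M) j v := by
    rw [← Finset.sum_subset (Finset.subset_univ S)]
    · exact Finset.sum_congr rfl fun j hj => by simp [restrictOne, hv, hj]
    · intro j _ hj
      have : v ≠ j := fun h => hj (h ▸ hv)
      simp [restrictOne, hj, this]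
  rw [h1, ← Finset.add_sum_erase _ _ hv, adjugate_apply, det_restrictOne_updateRow_self]
  congr 1
  refine Finset.sum_congr rfl fun u hu => ?_
  obtain ⟨huv, huS⟩ := Finset.mem_erase.mp hu
  rw [adjugate_apply, det_eq_sum_mul_adjugate_col _ v, Finset.mul_sum,
    ← Finset.sum_subset (Finset.subset_univ (S.erase v))]
  · refine Finset.sum_congr rfl fun w hw => ?_
    obtain ⟨hwv, hwS⟩ := Finset.mem_erase.mp hw
    rw [adjugate_apply, updateRow_ne hwv, mul_assoc]
    simp [restrictOne, hwS, hv]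
  · intro w _ hw
    rcases eq_or_ne w v with rfl | hwv
    · simp [huv.symm]
    · have hwS : w ∉ S := fun h => hw (Finset.mem_erase.mpr ⟨hwv, h⟩)
      simp [updateRow_apply, hwv, restrictOne, hwS]

/-- A family of matrices with constant diagonal `x`, in which the pairs of opposite off-diagonal
entries have constant products `c` and can be negated independently of each other. -/
structure IsSignFamily {Ω : Type*} (M : Ω → Matrix W W ℝ) (x : ℝ) (c : W → W → ℝ) : Prop where
  diag : ∀ ω v, M ω v v = x
  mul_symm : ∀ ω u w, u ≠ w → M ω u w * M ω w u = c u w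
  flip : ∀ u w, u ≠ w → ∃ φ : Ω ≃ Ω, ∀ ω i j, M (φ ω) i j =
    if (i = u ∧ j = w) ∨ (i = w ∧ j = u) then -M ω i j else M ω i j

variable {Ω : Type*} [Fintype Ω]

/-- The sum of the determinants of the principal submatrices on `S`; for the matrices `x - A`, with
`A` a signed adjacency matrix, this is a multiple of the matching polynomial. -/
noncomputable def minorSum (M : Ω → Matrix W W ℝ) (S : Finset W) : ℝ :=
  ∑ ω, (restrictOne S (M ω)).det

/-- This is the recurrence of the matching polynomial: in the expansion along row and column `v`,
only the terms with `w = u` survive the sum over signs. -/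
lemma minorSum_eq {M : Ω → Matrix W W ℝ} {x : ℝ} {c : W → W → ℝ} (hM : IsSignFamily M x c)
    {S : Finset W} {v : W} (hv : v ∈ S) :
    minorSum M S = x * minorSum M (S.erase v) -
      ∑ u ∈ S.erase v, c v u * minorSum M ((S.erase v).erase u) := by
  have h0 : minorSum M S = x * minorSum M (S.erase v) +
      ∑ u ∈ S.erase v, ∑ w ∈ S.erase v, ∑ ω, M ω v u * M ω w v *
        (((restrictOne S (M ω)).updateRow v (Pi.single u 1)).updateRow w (Pi.single v 1)).det := by
    simp only [minorSum, Finset.mul_sum]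
    rw [Finset.sum_congr rfl fun u _ => Finset.sum_comm, Finset.sum_comm,
      ← Finset.sum_add_distrib]
    exact Finset.sum_congr rfl fun ω _ => by rw [det_restrictOne_expand _ hv, hM.diag]
  rw [h0, sub_eq_add_neg, ← Finset.sum_neg_distrib]
  congr 1
  refine Finset.sum_congr rfl fun u hu => ?_
  obtain ⟨huv, huS⟩ := Finset.mem_erase.mp hu
  rw [Finset.sum_eq_single_of_mem u hu]
  · simp only [minorSum, Finset.mul_sum, ← Finset.sum_neg_distrib]
    refine Finset.sum_congr rfl fun ω _ => ?_
    rw [hM.mul_symm ω v u huv.symm, det_restrictOne_updateRow_swap _ huv, mul_neg]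
  · intro w hw hwu
    obtain ⟨hwv, hwS⟩ := Finset.mem_erase.mp hw
    obtain ⟨φ, hφ⟩ := hM.flip v u huv.symm
    -- Flipping the pair `{v, u}` negates the factor `M ω v u` only: in the determinant, row `v` is
    -- replaced and column `v` is irrelevant.
    have key : ∀ ω, M (φ ω) v u * M (φ ω) w v * (((restrictOne S (M (φ ω))).updateRow v
          (Pi.single u 1)).updateRow w (Pi.single v 1)).det =
        -(M ω v u * M ω w v * (((restrictOne S (M ω)).updateRow v
          (Pi.single u 1)).updateRow w (Pi.single v 1)).det) := by
      intro ω
      rw [hφ ω v u, hφ ω w v, if_pos (by simp), if_neg (by simp [hwv, hwu])]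
      rw [det_eq_of_row_eq_single (w := w) (v := v)
        (N := ((restrictOne S (M (φ ω))).updateRow v (Pi.single u 1)).updateRow w (Pi.single v 1))
        (N' := ((restrictOne S (M ω)).updateRow v (Pi.single u 1)).updateRow w (Pi.single v 1))
        (by simp) (by simp) fun i j hi hj => ?_]
      · ring
      · rw [updateRow_ne hi, updateRow_ne hi]
        by_cases hiv : i = v
        · simp [hiv]
        · simp [restrictOne, hφ, hiv, hj]
    have h2 := Equiv.sum_comp φ fun ω => M ω v u * M ω w v * (((restrictOne S (M ω)).updateRow v
      (Pi.single u 1)).updateRow w (Pi.single v 1)).det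
    rw [Finset.sum_congr rfl fun ω _ => key ω, Finset.sum_neg_distrib] at h2
    linarith

lemma minorSum_empty (M : Ω → Matrix W W ℝ) : minorSum M ∅ = Fintype.card Ω := by
  have : ∀ ω, restrictOne ∅ (M ω) = 1 := fun ω => by
    ext i j; simp [restrictOne, one_apply]
  simp [minorSum, this]

/-- The Heilmann–Lieb bound. -/
lemma minorSum_pos_and_le [Nonempty Ω] {M : Ω → Matrix W W ℝ} {x : ℝ} {c : W → W → ℝ}
    (hM : IsSignFamily M x c) (hc : ∀ u w, c u w = 0 ∨ c u w = 1) (hsymm : ∀ u w, c u w = c w u)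
    {κ : ℝ} (hκ : 1 < κ) (hdeg : ∀ v, ∑ u, c v u ≤ κ ^ 2 + 1) (hx : 2 * κ ≤ x) (S : Finset W) :
    0 < minorSum M S ∧ ∀ v ∈ S, ∑ u ∈ S.erase v, c v u ≤ κ ^ 2 →
      κ * minorSum M (S.erase v) ≤ minorSum M S := by
  induction S using Finset.strongInduction with
  | H S ih =>
    have hc0 : ∀ u w, 0 ≤ c u w := fun u w => by rcases hc u w with h | h <;> simp [h]
    have step : ∀ v ∈ S, (x * κ - ∑ u ∈ S.erase v, c v u) * minorSum M (S.erase v) ≤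
        κ * minorSum M S := by
      intro v hv
      have hS := Finset.erase_ssubset hv
      have hterm : ∀ u ∈ S.erase v, c v u * (κ * minorSum M ((S.erase v).erase u)) ≤
          c v u * minorSum M (S.erase v) := by
        intro u hu
        rcases hc v u with h | h
        · simp [h]
        · refine mul_le_mul_of_nonneg_left ((ih _ hS).2 u hu ?_) (hc0 _ _)
          -- The induction hypothesis applies to `u` because its neighbour `v` is gone, leaving at
          -- most `κ ^ 2` neighbours.
          have h1 : c u v + ∑ w ∈ (S.erase v).erase u, c u w ≤ ∑ w, c u w := by
            rw [← Finset.sum_insert (by simp)]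
            exact Finset.sum_le_sum_of_subset_of_nonneg (Finset.subset_univ _)
              fun w _ _ => hc0 _ _
          rw [hsymm u v, h] at h1
          linarith [hdeg u]
      have hsum := Finset.sum_le_sum hterm
      rw [← Finset.sum_mul] at hsum
      have h2 : ∑ u ∈ S.erase v, c v u * (κ * minorSum M ((S.erase v).erase u)) =
          κ * ∑ u ∈ S.erase v, c v u * minorSum M ((S.erase v).erase u) := by
        rw [Finset.mul_sum]
        exact Finset.sum_congr rfl fun u _ => by ring
      rw [minorSum_eq hM hv]
      linarith
    refine ⟨?_, fun v hv hdv => ?_⟩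
    · rcases S.eq_empty_or_nonempty with rfl | ⟨v, hv⟩
      · rw [minorSum_empty]
        exact_mod_cast Fintype.card_pos
      · have h1 := step v hv
        have h2 : ∑ u ∈ S.erase v, c v u ≤ κ ^ 2 + 1 :=
          (Finset.sum_le_sum_of_subset_of_nonneg (Finset.subset_univ _)
            fun w _ _ => hc0 _ _).trans (hdeg v)
        -- Even at full degree, `x * κ - (κ ^ 2 + 1) ≥ κ ^ 2 - 1 > 0`.
        have h3 : 0 < x * κ - ∑ u ∈ S.erase v, c v u := by nlinarith
        have h4 := mul_pos h3 (ih _ (Finset.erase_ssubset hv)).1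
        exact pos_of_mul_pos_right (h4.trans_le h1) (by linarith)
    · have h1 := step v hv
      have h2 := (ih _ (Finset.erase_ssubset hv)).1
      have h3 : κ ^ 2 ≤ x * κ - ∑ u ∈ S.erase v, c v u := by nlinarith
      have h4 : κ * (κ * minorSum M (S.erase v)) ≤ κ * minorSum M S := by
        nlinarith [mul_le_mul_of_nonneg_right h3 h2.le]
      exact le_of_mul_le_mul_left h4 (by linarith)

theorem sum_det_pos [Nonempty Ω] {M : Ω → Matrix W W ℝ} {x : ℝ} {c : W → W → ℝ}
    (hM : IsSignFamily M x c) (hc : ∀ u w, c u w = 0 ∨ c u w = 1) (hsymm : ∀ u w, c u w = c w u)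
    {κ : ℝ} (hκ : 1 < κ) (hdeg : ∀ v, ∑ u, c v u ≤ κ ^ 2 + 1) (hx : 2 * κ ≤ x) :
    0 < ∑ ω, (M ω).det := by
  have h := (minorSum_pos_and_le hM hc hsymm hκ hdeg hx Finset.univ).1
  have h2 : ∀ ω, restrictOne Finset.univ (M ω) = M ω := fun ω => by ext; simp [restrictOne]
  simpa [minorSum, h2] using h

end MatchingPolynomial
end Matrix

/-! ### Existence of a good signing. -/

namespace Matrix

section TwoLift

lemma dotProduct_mulVec_le_of_charpoly_pos {W : Type*} [Fintype W] [DecidableEq W]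
    {A : Matrix W W ℝ} (hA : A.IsSymm) {R : ℝ} (h : ∀ x, R < x → 0 < A.charpoly.eval x)
    (w : W → ℝ) : w ⬝ᵥ A *ᵥ w ≤ R * (w ⬝ᵥ w) := by
  have hpsd : (Matrix.scalar W R - A).PosSemidef := by
    rw [posSemidef_iff_isHermitian_and_spectrum_nonneg]
    refine ⟨?_, fun μ hμ => ?_⟩
    · ext i j
      by_cases hij : i = j
      · simp [hij]
      · simp [hij, Ne.symm hij, hA.apply i j]
    · show 0 ≤ μ
      by_contra! hneg
      rw [spectrum.mem_iff] at hμ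
      apply hμ
      have h1 := h (R - μ) (by linarith)
      rw [eval_charpoly] at h1
      have h2 : algebraMap ℝ (Matrix W W ℝ) μ - (Matrix.scalar W R - A) =
          -(Matrix.scalar W (R - μ) - A) := by
        rw [map_sub, algebraMap_eq_diagonal]
        ext i j
        by_cases hij : i = j
        · simp [hij]
          ring
        · simp [hij]
      rw [h2, IsUnit.neg_iff, isUnit_iff_isUnit_det]
      exact h1.ne'.isUnit
  have h1 := hpsd.dotProduct_mulVec_nonneg w
  rw [star_trivial, sub_mulVec, dotProduct_sub] at h1
  have h2 : w ⬝ᵥ Matrix.scalar W R *ᵥ w = R * (w ⬝ᵥ w) := by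
    simp only [dotProduct, Finset.mul_sum, scalar_apply, mulVec_diagonal]
    exact Finset.sum_congr rfl fun i _ => by ring
  linarith

variable {V E : Type} [Fintype V] [Fintype E]

/-- A `0`-`1` matrix with all row sums and all column sums equal to `d`. -/
structure IsRegularIncidence (d : ℕ) (B : Matrix V E ℝ) : Prop where
  zero_or_one : ∀ v e, B v e = 0 ∨ B v e = 1
  row_sum : ∀ v, ∑ e, B v e = d
  col_sum : ∀ e, ∑ v, B v e = d

/-- The sign `1` or `-1`. -/
def boolSign (b : Bool) : ℝ := if b then 1 else -1

@[simp]
lemma boolSign_mul_self (b : Bool) : boolSign b * boolSign b = 1 := by cases b <;> simp [boolSign]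

@[simp]
lemma boolSign_not (b : Bool) : boolSign (!b) = -boolSign b := by cases b <;> simp [boolSign]

/-- The matrix obtained from `B` by changing the sign of the entries marked `false` in `s`. -/
def signed {m : ℕ} (B : Matrix V E ℝ) (φ : V × E ≃ Fin m) (s : Fin m → Bool) : Matrix V E ℝ :=
  of fun v e => boolSign (s (φ (v, e))) * B v e

variable [DecidableEq V] [DecidableEq E]

/-- The vector supported on the end points of the edge `(v, e)`, with relative sign `b`. -/
def edgeVector {m : ℕ} (B : Matrix V E ℝ) (φ : V × E ≃ Fin m) (i : Fin m) (b : Bool) :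
    V ⊕ E → ℝ :=
  Sum.elim (Pi.single (φ.symm i).1 (B (φ.symm i).1 (φ.symm i).2))
    (Pi.single (φ.symm i).2 (boolSign b * B (φ.symm i).1 (φ.symm i).2))

/-- Each edge adds 1 to the diagonal at both ends and its sign off the diagonal; regularity makes
the diagonal `d`. Non-edges give zero vectors, so all of `V × E` can serve as index set. -/
lemma sum_vecMulVec_edgeVector {d m : ℕ} {B : Matrix V E ℝ} (hB : IsRegularIncidence d B)
    (φ : V × E ≃ Fin m) (s : Fin m → Bool) :
    -(d : ℝ) • (1 : Matrix (V ⊕ E) (V ⊕ E) ℝ) +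
      ∑ i, vecMulVec (edgeVector B φ i (s i)) (edgeVector B φ i (s i)) =
      fromBlocks 0 (signed B φ s) (signed B φ s)ᵀ 0 := by
  have hsq : ∀ v e, B v e * B v e = B v e := fun v e => by
    rcases hB.zero_or_one v e with h | h <;> simp [h]
  have hsq' : ∀ b v e, boolSign b * B v e * (boolSign b * B v e) = B v e := fun b v e => by
    rw [mul_mul_mul_comm, boolSign_mul_self, hsq, one_mul]
  have hsq'' : ∀ b v e, B v e * (boolSign b * B v e) = boolSign b * B v e := fun b v e => by
    rw [mul_left_comm, hsq]
  rw [← φ.sum_comp]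
  ext a b
  rw [add_apply, sum_apply, Fintype.sum_prod_type]
  rcases a with a | a <;> rcases b with b | b
  · rcases eq_or_ne a b with rfl | hab
    · simp [edgeVector, vecMulVec_apply, Pi.single_apply, hsq, hB.row_sum]
    · simp [edgeVector, vecMulVec_apply, Pi.single_apply, hab]
  · simp [edgeVector, vecMulVec_apply, Pi.single_apply, signed, hsq'']
  · simp [edgeVector, vecMulVec_apply, Pi.single_apply, signed, mul_assoc, hsq]
  · rw [Finset.sum_comm]
    rcases eq_or_ne a b with rfl | hab
    · simp [edgeVector, vecMulVec_apply, Pi.single_apply, hsq', hB.col_sum]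
    · simp [edgeVector, vecMulVec_apply, Pi.single_apply, hab]

lemma isSignFamily_signed {d m : ℕ} {B : Matrix V E ℝ} (hB : IsRegularIncidence d B)
    (φ : V × E ≃ Fin m) (x : ℝ) :
    IsSignFamily (fun s : Fin m → Bool =>
      Matrix.scalar (V ⊕ E) x - fromBlocks 0 (signed B φ s) (signed B φ s)ᵀ 0) x
      (fromBlocks 0 B Bᵀ 0) where
  diag ω v := by cases v <;> simp
  mul_symm ω u w huw := by
    have hsq : ∀ v e, B v e * B v e = B v e := fun v e => by
      rcases hB.zero_or_one v e with h | h <;> simp [h]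
    rcases u with u | u <;> rcases w with w | w <;> simp [signed] at huw ⊢
    · simp [huw]
    · rw [mul_mul_mul_comm, boolSign_mul_self, hsq, one_mul]
    · rw [mul_mul_mul_comm, boolSign_mul_self, hsq, one_mul]
    · simp [huw]
  flip := by
    have key : ∀ v e, ∃ φ' : (Fin m → Bool) ≃ (Fin m → Bool), ∀ s v' e', signed B φ (φ' s) v' e' =
        if v' = v ∧ e' = e then -signed B φ s v' e' else signed B φ s v' e' := by
      intro v e
      refine ⟨Function.Involutive.toPerm (fun s => Function.update s (φ (v, e)) (!s (φ (v, e))))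
        fun s => by simp, fun s v' e' => ?_⟩
      change signed B φ (Function.update s (φ (v, e)) (!s (φ (v, e)))) v' e' = _
      by_cases h : v' = v ∧ e' = e
      · obtain ⟨rfl, rfl⟩ := h
        simp [signed]
      · have : φ (v', e') ≠ φ (v, e) := fun h' => h (by simpa using h')
        simp [signed, h, this]
    intro u w huw
    rcases u with u | u <;> rcases w with w | w
    -- Entries between vertices on the same side vanish, so negating them changes nothing.
    · refine ⟨Equiv.refl _, fun s i j => ?_⟩
      rw [Equiv.refl_apply]
      split_ifs with h
      · rcases h with ⟨rfl, rfl⟩ | ⟨rfl, rfl⟩ <;> simp [huw, huw.symm]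
      · rfl
    · obtain ⟨φ', h⟩ := key u w
      refine ⟨φ', fun s i j => ?_⟩
      rcases i with i | i <;> rcases j with j | j <;> simp [h, neg_ite, and_comm]
    · obtain ⟨φ', h⟩ := key w u
      refine ⟨φ', fun s i j => ?_⟩
      rcases i with i | i <;> rcases j with j | j <;> simp [h, neg_ite, and_comm]
    · refine ⟨Equiv.refl _, fun s i j => ?_⟩
      rw [Equiv.refl_apply]
      split_ifs with h
      · rcases h with ⟨rfl, rfl⟩ | ⟨rfl, rfl⟩ <;> simp [huw, huw.symm]
      · rfl

/-- Some signing of a `d`-regular bipartite graph has norm at most `2 √(d - 1)`. -/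
theorem exists_signed_le [Nonempty V] {d : ℕ} (hd : 3 ≤ d) {B : Matrix V E ℝ}
    (hB : IsRegularIncidence d B) :
    ∃ B' : Matrix V E ℝ, (∀ v e, B' v e = B v e ∨ B' v e = -B v e) ∧
      ∀ q : V → ℝ, (q ᵥ* B') ⬝ᵥ (q ᵥ* B') ≤ 4 * ((d : ℝ) - 1) * (q ⬝ᵥ q) := by
  have hd' : (3 : ℝ) ≤ d := by exact_mod_cast hd
  set κ := √((d : ℝ) - 1) with hκdef
  have hκ2 : κ ^ 2 = d - 1 := Real.sq_sqrt (by linarith)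
  have hκ : 1 < κ := by rw [hκdef, Real.lt_sqrt] <;> linarith
  set φ := Fintype.equivFin (V × E)
  have hA : (-(d : ℝ) • (1 : Matrix (V ⊕ E) (V ⊕ E) ℝ)).IsSymm := by
    rw [IsSymm, transpose_smul, transpose_one]
  obtain ⟨s, hs⟩ := exists_choice_charpoly_pos (edgeVector B φ) hA (R := 2 * κ) (by
    intro x hx
    simp only [choicePoly, eval_finsetSum, sum_vecMulVec_edgeVector hB, eval_charpoly]
    refine sum_det_pos (isSignFamily_signed hB φ x) ?_ ?_ hκ ?_ hx.le
    · rintro (u | u) (w | w) <;> simp [hB.zero_or_one]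
    · rintro (u | u) (w | w) <;> simp
    · rintro (u | u) <;> simp [hκ2, hB.row_sum, hB.col_sum])
  rw [sum_vecMulVec_edgeVector hB] at hs
  refine ⟨signed B φ s, fun v e => ?_, fun q => ?_⟩
  · cases hs : s (φ (v, e)) <;> simp [signed, boolSign, hs]
  · have hsymm : (fromBlocks 0 (signed B φ s) (signed B φ s)ᵀ 0).IsSymm := by
      simp [IsSymm, fromBlocks_transpose]
    -- With `N` the squared norm of the image of `q`, this test vector gives `4 κ N ≤ 2 κ (4 κ² (q
    -- ⬝ᵥ q) + N)`, which is the claim.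
    have h := dotProduct_mulVec_le_of_charpoly_pos hsymm hs
      (Sum.elim ((2 * κ) • q) (q ᵥ* signed B φ s))
    rw [fromBlocks_mulVec] at h
    simp only [Sum.elim_comp_inl, Sum.elim_comp_inr, zero_mulVec, zero_add, add_zero,
      sumElim_dotProduct_sumElim, mulVec_transpose, smul_vecMul, smul_dotProduct,
      dotProduct_smul, smul_eq_mul, dotProduct_mulVec] at h
    set N := (q ᵥ* signed B φ s) ⬝ᵥ (q ᵥ* signed B φ s)
    rw [← hκ2]
    nlinarith

end TwoLift
end Matrix

/-! ### Ramanujan incidence matrices and 2-lifts. -/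

namespace Matrix

section RamanujanIncidence

variable {V E : Type} [Fintype V] [Fintype E]

/-- The incidence matrix of a `d`-regular bipartite graph without twins on one side, whose
singular values on the vectors with zero sum are at most `2 √(d - 1)`. -/
structure IsRamanujanIncidence (d : ℕ) (B : Matrix V E ℝ) : Prop
    extends IsRegularIncidence d B where
  col_injective : Function.Injective B.col
  gap : ∀ x : V → ℝ, ∑ v, x v = 0 → (x ᵥ* B) ⬝ᵥ (x ᵥ* B) ≤ 4 * ((d : ℝ) - 1) * (x ⬝ᵥ x)

/-- The all-ones matrix minus the identity acts as `-1` on zero-sum vectors. -/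
lemma isRamanujanIncidence_complete {d : ℕ} (hd : 3 ≤ d) :
    IsRamanujanIncidence d
      (of fun i j : Fin (d + 1) => if i = j then (0 : ℝ) else 1) where
  zero_or_one v e := by by_cases h : v = e <;> simp [h]
  row_sum v := by
    have : ∀ e : Fin (d + 1), (if v = e then (0 : ℝ) else 1) = 1 - if v = e then 1 else 0 :=
      fun e => by split_ifs <;> simp
    simp only [of_apply, this, Finset.sum_sub_distrib]
    simp
  col_sum e := by
    have : ∀ v : Fin (d + 1), (if v = e then (0 : ℝ) else 1) = 1 - if v = e then 1 else 0 :=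
      fun v => by split_ifs <;> simp
    simp only [of_apply, this, Finset.sum_sub_distrib]
    simp
  col_injective e e' h := by
    have := congrFun h e
    simpa [col, eq_comm] using this
  gap x hx := by
    have hd' : (3 : ℝ) ≤ d := by exact_mod_cast hd
    have h : x ᵥ* (of fun i j : Fin (d + 1) => if i = j then (0 : ℝ) else 1) = -x := by
      ext j
      have : ∀ v, x v * (if v = j then (0 : ℝ) else 1) = x v - if v = j then x v else 0 :=
        fun v => by split_ifs <;> simp
      simp [vecMul, dotProduct, this, Finset.sum_sub_distrib, hx]
    rw [h, neg_dotProduct_neg]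
    have h0 : 0 ≤ x ⬝ᵥ x := Finset.sum_nonneg fun i _ => mul_self_nonneg _
    nlinarith

/-- The incidence matrix of the 2-lift given by a signing `B'` of `B`. -/
noncomputable def twoLift (B B' : Matrix V E ℝ) : Matrix (V ⊕ V) (E ⊕ E) ℝ :=
  fromBlocks ((2⁻¹ : ℝ) • (B + B')) ((2⁻¹ : ℝ) • (B - B')) ((2⁻¹ : ℝ) • (B - B'))
    ((2⁻¹ : ℝ) • (B + B'))

/-- A vector on the lift splits into the sum and the difference of its two halves: `B` acts on the
former, which has zero sum, and `B'` on the latter. -/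
lemma IsRamanujanIncidence.twoLift {d : ℕ} (hd : d ≠ 0) {B B' : Matrix V E ℝ}
    (hB : IsRamanujanIncidence d B) (hs : ∀ v e, B' v e = B v e ∨ B' v e = -B v e)
    (hgap : ∀ q : V → ℝ, (q ᵥ* B') ⬝ᵥ (q ᵥ* B') ≤ 4 * ((d : ℝ) - 1) * (q ⬝ᵥ q)) :
    IsRamanujanIncidence d (twoLift B B') where
  zero_or_one v e := by
    have h1 : ∀ v e, 2⁻¹ * (B v e + B' v e) = 0 ∨ 2⁻¹ * (B v e + B' v e) = 1 := fun v e => by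
      rcases hB.zero_or_one v e with h | h <;> rcases hs v e with h' | h' <;> norm_num [h, h']
    have h2 : ∀ v e, 2⁻¹ * (B v e - B' v e) = 0 ∨ 2⁻¹ * (B v e - B' v e) = 1 := fun v e => by
      rcases hB.zero_or_one v e with h | h <;> rcases hs v e with h' | h' <;> norm_num [h, h']
    rcases v with v | v <;> rcases e with e | e
    · exact h1 v e
    · exact h2 v e
    · exact h2 v e
    · exact h1 v e
  row_sum v := by
    rw [Fintype.sum_sum_type, ← Finset.sum_add_distrib]
    rcases v with v | v <;> rw [← hB.row_sum v] <;>
      exact Finset.sum_congr rfl fun e _ => by simp [Matrix.twoLift]; ring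
  col_sum e := by
    rw [Fintype.sum_sum_type, ← Finset.sum_add_distrib]
    rcases e with e | e <;> rw [← hB.col_sum e] <;>
      exact Finset.sum_congr rfl fun v _ => by simp [Matrix.twoLift]; ring
  col_injective := by
    have key : ∀ i j : E ⊕ E, (Matrix.twoLift B B').col i = (Matrix.twoLift B B').col j →
        ∀ v, B v (i.elim id id) = B v (j.elim id id) := by
      intro i j h v
      have h1 := congrFun h (Sum.inl v)
      have h2 := congrFun h (Sum.inr v)
      rcases i with i | i <;> rcases j with j | j <;>
        simp [Matrix.twoLift, col] at h1 h2 ⊢ <;> linarith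
    -- The two columns over one edge could agree only if that column of `B` were zero, which `d ≠ 0`
    -- excludes.
    have hne : ∀ e, (Matrix.twoLift B B').col (Sum.inl e) ≠
        (Matrix.twoLift B B').col (Sum.inr e) := by
      intro e h
      have h0 : ∀ v, B v e = 0 := fun v => by
        have h1 := congrFun h (Sum.inl v)
        simp [Matrix.twoLift, col] at h1
        rcases hs v e with h' | h' <;> linarith
      have h2 := hB.col_sum e
      simp [h0] at h2
      exact hd (by exact_mod_cast h2.symm)
    intro i j h
    have hij := hB.col_injective (funext (key i j h))
    rcases i with i | i <;> rcases j with j | j <;> simp only [Sum.elim_inl, Sum.elim_inr, id] at hij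
    · rw [hij]
    · subst hij; exact absurd h (hne _)
    · subst hij; exact absurd h.symm (hne _)
    · rw [hij]
  gap x hx := by
    set y : V → ℝ := x ∘ Sum.inl
    set z : V → ℝ := x ∘ Sum.inr
    have hsum : ∑ v, (y + z) v = 0 := by
      rw [Fintype.sum_sum_type] at hx
      simpa [Finset.sum_add_distrib, y, z] using hx
    have hp := hB.gap (y + z) hsum
    have hq := hgap (y - z)
    have hx2 : x ⬝ᵥ x = y ⬝ᵥ y + z ⬝ᵥ z := by
      rw [dotProduct, Fintype.sum_sum_type]; rfl
    have h1 : x ᵥ* Matrix.twoLift B B' =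
        Sum.elim ((2⁻¹ : ℝ) • ((y + z) ᵥ* B + (y - z) ᵥ* B'))
          ((2⁻¹ : ℝ) • ((y + z) ᵥ* B - (y - z) ᵥ* B')) := by
      rw [Matrix.twoLift, vecMul_fromBlocks]
      congr 1 <;>
      · simp only [vecMul_smul, vecMul_add, vecMul_sub, add_vecMul, sub_vecMul]
        module
    rw [h1, sumElim_dotProduct_sumElim, hx2]
    set P := (y + z) ᵥ* B
    set Q := (y - z) ᵥ* B'
    simp only [smul_dotProduct, dotProduct_smul, smul_eq_mul, add_dotProduct, dotProduct_add,
      sub_dotProduct, dotProduct_sub] at hp hq ⊢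
    linarith

/-- There are arbitrarily large Ramanujan incidence matrices. -/
theorem exists_isRamanujanIncidence {d : ℕ} (hd : 3 ≤ d) (k : ℕ) :
    ∃ (V E : Type) (_ : Fintype V) (_ : Fintype E) (B : Matrix V E ℝ),
      Fintype.card V = 2 ^ k * (d + 1) ∧ IsRamanujanIncidence d B := by
  classical
  induction k with
  | zero => exact ⟨Fin (d + 1), Fin (d + 1), inferInstance, inferInstance, _, by simp,
      isRamanujanIncidence_complete hd⟩
  | succ k ih =>
    obtain ⟨V, E, _, _, B, hcard, hB⟩ := ih
    have : Nonempty V := Fintype.card_pos_iff.mp (by rw [hcard]; positivity)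
    obtain ⟨B', hs, hgap⟩ := exists_signed_le hd hB.toIsRegularIncidence
    exact ⟨V ⊕ V, E ⊕ E, inferInstance, inferInstance, twoLift B B',
      by rw [Fintype.card_sum, hcard]; ring, hB.twoLift (by omega) hs hgap⟩

/-- A function which is constant on the edges is constant. -/
lemma IsRamanujanIncidence.eq_of_forall_edge [Nonempty V] {d : ℕ} (hd : 3 ≤ d) {B : Matrix V E ℝ}
    (hB : IsRamanujanIncidence d B) {x : V → ℝ}
    (hx : ∀ e u v, B u e = 1 → B v e = 1 → x u = x v) (u v : V) : x u = x v := by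
  have hd' : (3 : ℝ) ≤ d := by exact_mod_cast hd
  -- Subtract the mean. A zero-sum `y` constant on edges has its squared norm multiplied by `d ^ 2`
  -- under `B`, and `d ^ 2 > 4 (d - 1)`, so the gap forces `y = 0`.
  suffices H : ∀ y : V → ℝ, (∀ e u v, B u e = 1 → B v e = 1 → y u = y v) → ∑ v, y v = 0 →
      y = 0 by
    have := H (fun w => x w - (∑ w, x w) / Fintype.card V)
      (fun e u v hu hv => by rw [hx e u v hu hv])
      (by rw [Finset.sum_sub_distrib, Finset.sum_const, Finset.card_univ, nsmul_eq_mul,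
            mul_div_cancel₀ _ (by simp), sub_self])
    have h1 := congrFun this u
    have h2 := congrFun this v
    simp only [Pi.zero_apply] at h1 h2
    linarith
  intro y hy hsum
  have hedge : ∀ e, (y ᵥ* B) e * (y ᵥ* B) e = d * ∑ v, y v * y v * B v e := by
    intro e
    by_cases hne : ∃ u, B u e = 1
    · obtain ⟨u, hu⟩ := hne
      have h1 : ∀ v, y v * B v e = y u * B v e := fun v => by
        rcases hB.zero_or_one v e with h | h
        · simp [h]
        · rw [hy e v u h hu]
      have h2 : ∀ v, y v * y v * B v e = y u * y u * B v e := fun v => by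
        rw [mul_assoc, h1, mul_left_comm, h1, mul_assoc]
      simp only [vecMul, dotProduct, h1, h2, ← Finset.mul_sum, hB.col_sum]
      ring
    · have h0 : ∀ v, B v e = 0 := fun v =>
        (hB.zero_or_one v e).resolve_right fun h => hne ⟨v, h⟩
      simp [vecMul, dotProduct, h0]
  have hnorm : (y ᵥ* B) ⬝ᵥ (y ᵥ* B) = d * d * (y ⬝ᵥ y) := by
    rw [dotProduct, Finset.sum_congr rfl fun e _ => hedge e, ← Finset.mul_sum, Finset.sum_comm]
    simp only [← Finset.mul_sum, hB.row_sum, dotProduct, ← Finset.sum_mul]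
    ring
  have hgap := hB.gap y hsum
  rw [hnorm] at hgap
  have h0 : 0 ≤ y ⬝ᵥ y := Finset.sum_nonneg fun i _ => mul_self_nonneg _
  have h1 : y ⬝ᵥ y = 0 := by
    have h2 : 0 < (d : ℝ) * d - 4 * (d - 1) := by nlinarith
    nlinarith
  exact dotProduct_self_eq_zero.mp h1

end RamanujanIncidence
end Matrix

/-! ### From incidence matrices to hypergraphs. -/

namespace Hypergraph

section OfIncidence

variable {V E : Type} [Fintype V] [Fintype E]

/-- The hypergraph whose edges are the supports of the columns of a `0`-`1` matrix. -/
def ofIncidence (B : Matrix V E ℝ) : Hypergraph V where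
  vertexSet := Set.univ
  edgeSet := Set.range fun e => {v | B v e = 1}
  subset_vertexSet_of_mem_edgeSet' _ _ := Set.subset_univ _

noncomputable instance (B : Matrix V E ℝ) : Fintype (ofIncidence B).vertexSet :=
  inferInstanceAs (Fintype (Set.univ : Set V))

open Matrix

lemma _root_.Matrix.IsRegularIncidence.mul_transpose_eq_ncard {d : ℕ} {B : Matrix V E ℝ}
    (hB : IsRegularIncidence d B) (u v : V) :
    ((B * Bᵀ) u v : ℝ) = ({e | B u e = 1 ∧ B v e = 1}.ncard : ℝ) := by
  classical
  rw [Matrix.mul_apply, Set.ncard_eq_toFinset_card', Finset.card_eq_sum_ones, Nat.cast_sum,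
    Set.toFinset_ofPred, Finset.sum_filter]
  refine Finset.sum_congr rfl fun e _ => ?_
  rcases hB.zero_or_one u e with h | h <;> rcases hB.zero_or_one v e with h' | h' <;> simp [h, h']

lemma _root_.Matrix.IsRegularIncidence.mul_transpose_self {d : ℕ} {B : Matrix V E ℝ}
    (hB : IsRegularIncidence d B) (v : V) : (B * Bᵀ) v v = d := by
  rw [Matrix.mul_apply, ← hB.row_sum v]
  refine Finset.sum_congr rfl fun e _ => ?_
  rcases hB.zero_or_one v e with h | h <;> simp [h]

variable {d : ℕ} {B : Matrix V E ℝ} (hB : IsRamanujanIncidence d B)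
include hB

/-- The edges form a set, so degrees and codegrees can be counted on columns only if distinct
columns have distinct supports. -/
lemma injective_edge : Function.Injective fun e => {v | B v e = 1} := by
  intro e e' h
  refine hB.col_injective (funext fun v => ?_)
  have hv : B v e = 1 ↔ B v e' = 1 := Set.ext_iff.mp h v
  show B v e = B v e'
  rcases hB.zero_or_one v e with h1 | h1 <;> rcases hB.zero_or_one v e' with h2 | h2 <;>
    simp_all

lemma isBiregular_ofIncidence (hd : 2 ≤ d) : (ofIncidence B).IsBiregular d d := by
  refine ⟨fun v _ => ?_, hd, ?_⟩
  · have h : {e | e ∈ (ofIncidence B).edgeSet ∧ v ∈ e} =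
        (fun e => {v | B v e = 1}) '' {e | B v e = 1} := by
      ext s
      constructor
      · rintro ⟨⟨e, rfl⟩, hv⟩
        exact ⟨e, hv, rfl⟩
      · rintro ⟨e, hv, rfl⟩
        exact ⟨⟨e, rfl⟩, hv⟩
    rw [h, (injective_edge hB).encard_image, ← Set.Finite.cast_ncard_eq (Set.toFinite _)]
    have h1 := hB.mul_transpose_self v
    rw [hB.mul_transpose_eq_ncard] at h1
    simp only [and_self] at h1
    exact_mod_cast h1
  · rintro _ ⟨e, rfl⟩
    rw [← Set.Finite.cast_ncard_eq (Set.toFinite _)]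
    classical
    have h1 := hB.col_sum e
    have h2 : ∀ v, B v e = if B v e = 1 then 1 else 0 := fun v => by
      rcases hB.zero_or_one v e with h | h <;> simp [h]
    rw [Finset.sum_congr rfl fun v _ => h2 v, Finset.sum_boole] at h1
    rw [Set.ncard_eq_toFinset_card', Set.toFinset_ofPred]
    exact_mod_cast h1

/-- The indicator function of the vertices reachable from `u` is constant on edges, hence constant.
-/
lemma isConnected_ofIncidence [Nonempty V] (hd : 3 ≤ d) : (ofIncidence B).IsConnected := by
  classical
  refine ⟨Set.univ_nonempty, fun u _ v _ => ?_⟩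
  have h := hB.eq_of_forall_edge hd
    (x := fun w => if Relation.ReflTransGen (ofIncidence B).Adj u w then 1 else 0)
    (fun e a b ha hb => by
      have hab : (ofIncidence B).Adj a b := ⟨_, ⟨e, rfl⟩, ha, hb⟩
      exact if_congr ⟨fun h => h.tail hab, fun h => h.tail hab.symm⟩ rfl rfl) u v
  by_contra hne
  simp [hne, Relation.ReflTransGen.refl] at h

lemma adjacencyMatrix_ofIncidence [DecidableEq V] (u v : (ofIncidence B).vertexSet) :
    (ofIncidence B).adjacencyMatrix u v = (B * Bᵀ) u v - if u.1 = v.1 then (d : ℝ) else 0 := by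
  by_cases huv : u = v
  · subst huv
    rw [hB.mul_transpose_self]
    simp [adjacencyMatrix]
  · have huv' : u.1 ≠ v.1 := fun h => huv (Subtype.ext h)
    have h : {e | e ∈ (ofIncidence B).edgeSet ∧ u.1 ∈ e ∧ v.1 ∈ e} =
        (fun e => {v | B v e = 1}) '' {e | B u e = 1 ∧ B v e = 1} := by
      ext s
      constructor
      · rintro ⟨⟨e, rfl⟩, hv⟩
        exact ⟨e, hv, rfl⟩
      · rintro ⟨e, hv, rfl⟩
        exact ⟨⟨e, rfl⟩, hv⟩
    rw [hB.mul_transpose_eq_ncard, ← Set.ncard_image_of_injective _ (injective_edge hB), ← h]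
    simp only [adjacencyMatrix, of_apply, huv, huv', if_false, sub_zero]

theorem isRamanujan_ofIncidence [Nonempty V] (hd : 3 ≤ d) : (ofIncidence B).IsRamanujan d d := by
  classical
  refine ⟨isConnected_ofIncidence hB hd, isBiregular_ofIncidence hB (by omega),
    fun μ hμ hne => ?_⟩
  have hd' : (3 : ℝ) ≤ d := by exact_mod_cast hd
  -- The bound holds for all nontrivial eigenvalues, so removing obvious ones plays no role.
  have hroot := Multiset.mem_of_le (Multiset.sub_le_self _ _) hμ
  rw [eigenvalues, mem_roots (charpoly_monic _).ne_zero, IsRoot, eval_charpoly] at hroot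
  obtain ⟨x, hx0, hx⟩ := exists_mulVec_eq_zero_iff.mpr hroot
  let ψ : V ≃ (ofIncidence B).vertexSet :=
    ⟨fun v => ⟨v, Set.mem_univ v⟩, Subtype.val, fun _ => rfl, fun _ => rfl⟩
  set y : V → ℝ := fun v => x (ψ v)
  have hy0 : y ≠ 0 := fun h => hx0 (funext fun v => congrFun h v.1)
  have hBy : (B * Bᵀ) *ᵥ y = (μ + d) • y := by
    ext v
    have h1 := congrFun hx (ψ v)
    rw [sub_mulVec, Pi.sub_apply, scalar_apply, mulVec_diagonal, Pi.zero_apply, sub_eq_zero,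
      mulVec, dotProduct, ← ψ.sum_comp] at h1
    have h2 : ∀ w, (ofIncidence B).adjacencyMatrix (ψ v) (ψ w) * x (ψ w) =
        (B * Bᵀ) v w * y w - if v = w then d * y w else 0 := fun w => by
      rw [adjacencyMatrix_ofIncidence hB, sub_mul, ite_mul, zero_mul]
      rfl
    rw [Finset.sum_congr rfl fun w _ => h2 w, Finset.sum_sub_distrib, Finset.sum_ite_eq,
      if_pos (Finset.mem_univ v)] at h1
    rw [Pi.smul_apply, smul_eq_mul, mulVec, dotProduct, add_mul]
    exact (sub_eq_iff_eq_add.mp h1.symm)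
  -- The all-ones vector has eigenvalue `d * d` for `B * Bᵀ`, which differs from `μ + d` for
  -- nontrivial `μ`.
  have hsum : ∑ v, y v = 0 := by
    have h1 : (fun _ => 1) ⬝ᵥ ((B * Bᵀ) *ᵥ y) = d * d * ∑ v, y v := by
      rw [← mulVec_mulVec, dotProduct_mulVec, dotProduct_mulVec]
      have h2 : (fun _ => (1 : ℝ)) ᵥ* B = fun _ => (d : ℝ) := by
        ext e; simp [vecMul, dotProduct, hB.col_sum]
      have h3 : (fun _ => (d : ℝ)) ᵥ* Bᵀ = fun _ => (d : ℝ) * d := by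
        ext v; simp [vecMul, dotProduct, ← Finset.mul_sum, hB.row_sum]
      rw [h2, h3, dotProduct, Finset.mul_sum]
    rw [hBy, dotProduct_smul, smul_eq_mul] at h1
    simp only [dotProduct, one_mul] at h1
    have h2 : (μ - d * (d - 1)) * ∑ v, y v = 0 := by linear_combination h1
    exact (mul_eq_zero.mp h2).resolve_left (sub_ne_zero.mpr hne)
  have hnorm : (y ᵥ* B) ⬝ᵥ (y ᵥ* B) = (μ + d) * (y ⬝ᵥ y) := by
    rw [← smul_eq_mul, ← dotProduct_smul, ← hBy, ← mulVec_mulVec, dotProduct_mulVec,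
      mulVec_transpose]
  have hpos : 0 < y ⬝ᵥ y :=
    lt_of_le_of_ne (Finset.sum_nonneg fun i _ => mul_self_nonneg _)
      fun h => hy0 (dotProduct_self_eq_zero.mp h.symm)
  have hle := hB.gap y hsum
  rw [hnorm] at hle
  have hge : 0 ≤ (μ + d) * (y ⬝ᵥ y) := by
    rw [← hnorm]
    exact Finset.sum_nonneg fun i _ => mul_self_nonneg _
  have h1 := le_of_mul_le_mul_right hle hpos
  have h2 := nonneg_of_mul_nonneg_left hge hpos
  rw [Real.sqrt_mul_self (by linarith), abs_le]
  constructor <;> linarith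

end OfIncidence

end Hypergraph

theorem corollary5p3 (d : ℕ) (hd : 3 ≤ d) :
    ∃ (V : ℕ → Type) (H : ∀ k : ℕ, Hypergraph (V k)) (_ : ∀ k : ℕ, Fintype (H k).vertexSet),
      (∀ k : ℕ, (H k).IsRamanujan d d) ∧ StrictMono fun k : ℕ => (H k).vertexSet.ncard := by
  choose V E _ _ B hcard hB using fun k => Matrix.exists_isRamanujanIncidence hd k
  refine ⟨V, fun k => Hypergraph.ofIncidence (B k), fun k => inferInstance, fun k => ?_, ?_⟩
  · have : Nonempty (V k) := Fintype.card_pos_iff.mp (by rw [hcard]; positivity)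
    exact Hypergraph.isRamanujan_ofIncidence (hB k) hd
  · refine strictMono_nat_of_lt_succ fun k => ?_
    show (Set.univ : Set (V k)).ncard < (Set.univ : Set (V (k + 1))).ncard
    rw [Set.ncard_univ, Set.ncard_univ, Nat.card_eq_fintype_card, Nat.card_eq_fintype_card, hcard,
      hcard, pow_succ]
    nlinarith [Nat.pos_of_ne_zero (pow_ne_zero k two_ne_zero)]
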